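/- Let $K$ be a field of characteristic $0$, let $n\ge 1$, and let $S=K[X_0,\dots,X_n]$ be the standard graded polynomial ring. Let $P_1,\dots,P_s$ be distinct $K$-rational points of $\mathbb{P}^n$ with homogeneous vanishing ideals $I_{P_1},\dots,I_{P_s}\subseteq S$, and let $m_1,\dots,m_s$ be positive integers. Let $\mathbb{W}=m_1P_1+\cdots+m_sP_s$ be the fat point scheme in $\mathbb{P}^n$ defined by $I_{\mathbb{W}}=I_{P_1}^{m_1}\cap\cdots\cap I_{P_s}^{m_s}$, with homogeneous coordinate ring $R_{\mathbb{W}}=S/I_{\mathbb{W}}$, and let $\mathbb{Y}=(m_1-1)P_1+\cdots+(m_s-1)P_s$ be its slimming, with ideal $I_{\mathbb{Y}}=I_{P_1}^{m_1-1}\cap\cdots\cap I_{P_s}^{m_s-1}$ (where $I_{P_j}^0=S$) and coordinate ring $R_{\mathbb{Y}}=S/I_{\mathbb{Y}}$. Let $\Omega^{n+1}_{R_{\mathbb{W}}/K}=\bigwedge^{n+1}_{R_{\mathbb{W}}}\Omega^1_{R_{\mathbb{W}}/K}$ be the module of Kähler differential $(n+1)$-forms, graded so that the universal derivation $d$ has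 degree $0$; thus its component of degree $i$ is the $K$-span of the forms $f\,dg_1\wedge\cdots\wedge dg_{n+1}$ with $f,g_1,\dots,g_{n+1}\in R_{\mathbb{W}}$ homogeneous and $\deg f+\sum_j\deg g_j=i$. The Hilbert polynomial $\operatorname{HP}_M(z)\in\mathbb{Q}[z]$ of a finitely generated graded module $M$ is the polynomial with $\operatorname{HP}_M(i)=\dim_K M_i$ for all sufficiently large $i$. Then $$\operatorname{HP}_{\Omega^{n+1}_{R_{\mathbb{W}}/K}}(z)=\operatorname{HP}_{R_{\mathbb{Y}}}(z)=\sum_{j=1}^{s}\binom{m_j+n-2}{n},$$ a constant polynomial. -/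

import Mathlib

open scoped LinearAlgebra.Projectivization KaehlerDifferential

namespace FatPoints

noncomputable section

/-- The homogeneous vanishing ideal in `K[X_0, …, X_n]` of a `K`-rational point of `ℙⁿ`: the ideal
generated by the homogeneous polynomials that vanish at the point. (For a homogeneous polynomial,
vanishing does not depend on the representative of the point.) -/
def pointIdeal {K : Type*} [Field K] {n : ℕ} (P : ℙ K (Fin (n + 1) → K)) :
    Ideal (MvPolynomial (Fin (n + 1)) K) :=
  Ideal.span {F | (∃ d : ℕ, F.IsHomogeneous d) ∧ MvPolynomial.eval P.rep F = 0}

/-- The ideal `I_W = ⋂ⱼ I_{Pⱼ} ^ mⱼ` of the scheme `W = m₁P₁ + ⋯ + mₛPₛ`. Points of multiplicity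
zero do not contribute, as `I ^ 0` is the unit ideal. -/
def fatPointIdeal {K : Type*} [Field K] {n s : ℕ} (P : Fin s → ℙ K (Fin (n + 1) → K))
    (m : Fin s → ℕ) : Ideal (MvPolynomial (Fin (n + 1)) K) :=
  ⨅ j, pointIdeal (P j) ^ m j

/-- The homogeneous coordinate ring `R_W = K[X_0, …, X_n] / I_W`. -/
abbrev coordRing {K : Type*} [Field K] {n s : ℕ} (P : Fin s → ℙ K (Fin (n + 1) → K))
    (m : Fin s → ℕ) : Type _ :=
  MvPolynomial (Fin (n + 1)) K ⧸ fatPointIdeal P m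

/-- The homogeneous component `(R_W)_i`: the residue classes of the forms of degree `i`. -/
def coordRingComponent {K : Type*} [Field K] {n s : ℕ} (P : Fin s → ℙ K (Fin (n + 1) → K))
    (m : Fin s → ℕ) (i : ℕ) : Submodule K (coordRing P m) :=
  (MvPolynomial.homogeneousSubmodule (Fin (n + 1)) K i).map
    (Ideal.Quotient.mkₐ K (fatPointIdeal P m)).toLinearMap

/-- The module `Ω^k_{R/K} = ⋀^k_R Ω¹_{R/K}` of Kähler differential `k`-forms. -/
abbrev KaehlerForms (K R : Type*) [CommRing K] [CommRing R] [Algebra K R] (k : ℕ) : Type _ :=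
  ⋀[R]^k (Ω[R⁄K])

/-- The grading on `Ω^k_{R/K}` induced by a grading `𝒜` of `R`, for which the universal derivation
has degree zero: the component of degree `i` is spanned over `K` by the forms
`f dg₁ ∧ ⋯ ∧ dg_k` with `f, g₁, …, g_k` homogeneous and `deg f + deg g₁ + ⋯ + deg g_k = i`. -/
def kaehlerFormsComponent {K R : Type*} [CommRing K] [CommRing R] [Algebra K R]
    (𝒜 : ℕ → Submodule K R) (k i : ℕ) : Submodule K (KaehlerForms K R k) :=
  Submodule.span K {ω | ∃ (a : ℕ) (b : Fin k → ℕ) (f : R) (g : Fin k → R),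
    f ∈ 𝒜 a ∧ (∀ j, g j ∈ 𝒜 (b j)) ∧ a + ∑ j, b j = i ∧
      ω = f • exteriorPower.ιMulti R k (fun j => KaehlerDifferential.D K R (g j))}

/-- `p` is the Hilbert polynomial of the family `M` of homogeneous components: all components are
finite-dimensional, and `dim_K M_i = p(i)` for all sufficiently large `i`. -/
def IsHilbertPolynomial {K V : Type*} [Field K] [AddCommGroup V] [Module K V]
    (M : ℕ → Submodule K V) (p : Polynomial ℚ) : Prop :=
  (∀ i, FiniteDimensional K (M i)) ∧
    ∀ᶠ i : ℕ in Filter.atTop, (Module.finrank K (M i) : ℚ) = p.eval (i : ℚ)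

/-- There is at most one Hilbert polynomial. -/
theorem IsHilbertPolynomial.unique {K V : Type*} [Field K] [AddCommGroup V] [Module K V]
    {M : ℕ → Submodule K V} {p q : Polynomial ℚ} (hp : IsHilbertPolynomial M p)
    (hq : IsHilbertPolynomial M q) : p = q := by
  obtain ⟨N, hN⟩ := Filter.eventually_atTop.1 (hp.2.and hq.2)
  refine Polynomial.eq_of_infinite_eval_eq p q ?_
  refine ((Set.Ici_infinite N).image (Nat.cast_injective (R := ℚ)).injOn).mono ?_
  rintro _ ⟨i, hi, rfl⟩
  exact (hN i hi).1.symm.trans (hN i hi).2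

end

end FatPoints

/-! Write `I` for the ideal of the fat point scheme and `J` for `derivIdeal I`, generated by `I` and
all partial derivatives of its elements. Since the `dx_j` generate the differentials of `S/I`, the
top forms are generated by `dx_0 ∧ ⋯ ∧ dx_n`, and the annihilator of this form in `S` is exactly `J`
(`ker_volMap`). So the module of top forms is `S/J` shifted by `n + 1`.

The product rule puts `J` inside the ideal of the slimming. Conversely, let `p` be the ideal of one
point, generated by linear forms `ℓ_j = X_j - q_j X_k`. For `G ∈ p^e`, Euler's identity gives `∑
∂_j(ℓ_j G) ≡ (n + e) G` modulo `p^(e+1)`, and `n + e` is invertible in characteristic zero; hence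
`p^e ⊆ derivIdeal (p^(e+1))`. Thus the two ideals agree away from the irrelevant ideal, and
Artin–Rees makes them equal in all large degrees.

It remains to compute the Hilbert function of the slimming. A single `p^e` has codimension `(e+n-1
choose n)` in every degree at least `e`. For distinct points the codimensions add in large degrees,
because the sum of the ideals contains a power of the irrelevant ideal. -/

namespace FatPoints

open MvPolynomial

/-! ### Linear generators of the ideal of a point -/

section PointIdeal

variable {σ K : Type*} [Field K]

/-- Scaling the point at which a form is evaluated. -/
theorem aeval_mul_of_isHomogeneous {A : Type*} [CommRing A] [Algebra K A]
    {F : MvPolynomial σ K} {d : ℕ} (hF : F.IsHomogeneous d) (c : σ → A) (y : A) :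
    aeval (fun j => c j * y) F = aeval c F * y ^ d := by
  rw [aeval_def, aeval_def, eval₂_eq, eval₂_eq, Finset.sum_mul]
  refine Finset.sum_congr rfl fun a ha => ?_
  have hd : a.degree = d := by
    by_contra h
    exact (mem_support_iff.1 ha) (hF.coeff_eq_zero h)
  rw [← hd, Finsupp.degree_apply, mul_assoc, ← Finset.prod_pow_eq_pow_sum, ← Finset.prod_mul_distrib]
  simp only [mul_pow]

/-- The linear form `X_j - q_j X_k`. -/
noncomputable def linForm (q : σ → K) (k j : σ) : MvPolynomial σ K := X j - C (q j) * X k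

/-- The ideal generated by the linear forms `X_j - q_j X_k`. -/
noncomputable def linIdeal (q : σ → K) (k : σ) : Ideal (MvPolynomial σ K) :=
  Ideal.span (Set.range (linForm q k))

theorem linForm_mem (q : σ → K) (k j : σ) : linForm q k j ∈ linIdeal q k :=
  Ideal.subset_span ⟨j, rfl⟩

theorem linForm_self {q : σ → K} {k : σ} (hq : q k = 1) : linForm q k k = 0 := by
  simp [linForm, hq]

theorem isHomogeneous_linForm (q : σ → K) (k j : σ) : (linForm q k j).IsHomogeneous 1 :=
  (isHomogeneous_X _ _).sub (isHomogeneous_C_mul_X _ _)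

theorem X_eq_linForm_add (q : σ → K) (k j : σ) :
    (X j : MvPolynomial σ K) = linForm q k j + C (q j) * X k := by
  simp [linForm]

/-- Modulo the linear forms `X_j` equals `q_j X_k`, so the substitution induces the identity on the
quotient. -/
theorem sub_aeval_mem_linIdeal (q : σ → K) (k : σ) (F : MvPolynomial σ K) :
    F - aeval (fun j => C (q j) * X k) F ∈ linIdeal q k := by
  have h : (Ideal.Quotient.mkₐ K (linIdeal q k)).comp (aeval (fun j => C (q j) * X k)) =
      Ideal.Quotient.mkₐ K (linIdeal q k) := by
    ext j
    simp only [AlgHom.comp_apply, aeval_X]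
    refine (Ideal.Quotient.eq.2 ?_).symm
    exact linForm_mem q k j
  exact Ideal.Quotient.eq.1 (DFunLike.congr_fun h F).symm

theorem linIdeal_eq_ker {q : σ → K} {k : σ} (hq : q k = 1) :
    linIdeal q k =
      RingHom.ker (aeval (fun j => C (q j) * X k) : MvPolynomial σ K →ₐ[K] MvPolynomial σ K) := by
  apply le_antisymm
  · refine Ideal.span_le.2 ?_
    rintro _ ⟨j, rfl⟩
    simp [linForm, hq, RingHom.mem_ker, algHom_C, algebraMap_eq]
  · intro F hF
    have := sub_aeval_mem_linIdeal q k F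
    rwa [RingHom.mem_ker.1 hF, sub_zero] at this

theorem isPrime_linIdeal {q : σ → K} {k : σ} (hq : q k = 1) : (linIdeal q k).IsPrime := by
  rw [linIdeal_eq_ker hq]
  exact RingHom.ker_isPrime _

theorem X_notMem_linIdeal {q : σ → K} {k : σ} (hq : q k = 1) : X k ∉ linIdeal q k := by
  rw [linIdeal_eq_ker hq, RingHom.mem_ker]
  simp [hq]

theorem sub_eval_mem_linIdeal (q : σ → K) (k : σ) {F : MvPolynomial σ K} {d : ℕ}
    (hF : F.IsHomogeneous d) : F - C (eval q F) * X k ^ d ∈ linIdeal q k := by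
  have h := sub_aeval_mem_linIdeal q k F
  rw [aeval_mul_of_isHomogeneous hF (fun j => C (q j)) (X k)] at h
  have h2 : aeval (fun j => (C (q j) : MvPolynomial σ K)) F = C (eval q F) := by
    rw [aeval_def, eval_eq, eval₂_eq, map_sum]
    simp [algebraMap_eq]
  rwa [h2] at h

theorem linIdeal_le_idealOfVars (q : σ → K) (k : σ) : linIdeal q k ≤ idealOfVars σ K := by
  refine Ideal.span_le.2 ?_
  rintro _ ⟨j, rfl⟩
  exact sub_mem (Ideal.subset_span ⟨j, rfl⟩) (Ideal.mul_mem_left _ _ (Ideal.subset_span ⟨k, rfl⟩))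

theorem idealOfVars_le_of_linIdeal_le {q : σ → K} {k : σ} {p : Ideal (MvPolynomial σ K)}
    (h : linIdeal q k ≤ p) (hk : X k ∈ p) : idealOfVars σ K ≤ p := by
  refine Ideal.span_le.2 ?_
  rintro _ ⟨j, rfl⟩
  rw [X_eq_linForm_add q k j]
  exact add_mem (h (linForm_mem q k j)) (p.mul_mem_left _ hk)

end PointIdeal

/-- A derivation lowers the order of vanishing along an ideal by at most one. -/
theorem derivation_mem_pow {K A : Type*} [CommRing K] [CommRing A] [Algebra K A]
    (D : Derivation K A A) (I : Ideal A) (e : ℕ) : ∀ F ∈ I ^ (e + 1), D F ∈ I ^ e := by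
  induction e with
  | zero => simp
  | succ e ih =>
    intro F hF
    rw [pow_succ] at hF
    refine Submodule.mul_induction_on hF (fun f hf g hg => ?_) (fun f g hf hg => ?_)
    · rw [D.leibniz, smul_eq_mul, smul_eq_mul]
      refine add_mem (Ideal.mul_mem_right _ _ hf) ?_
      rw [pow_succ']
      exact Ideal.mul_mem_mul hg (ih f hf)
    · rw [map_add]; exact add_mem hf hg

/-! ### Euler's identity along a point -/

section Euler

variable {σ K : Type*} [Field K]

/-- The derivation `∑ⱼ (X_j - q_j X_k) ∂ⱼ`. -/
noncomputable def eulerDeriv (q : σ → K) (k : σ) :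
    Derivation K (MvPolynomial σ K) (MvPolynomial σ K) :=
  mkDerivation K (linForm q k)

/-- Since `q k = 1`, the derivation kills `X_k`; it is the Euler field of the chart centred at the
point. -/
theorem eulerDeriv_linForm {q : σ → K} {k : σ} (hq : q k = 1) (j : σ) :
    eulerDeriv q k (linForm q k j) = linForm q k j := by
  conv_lhs => rw [linForm]
  rw [map_sub, Derivation.leibniz, eulerDeriv, mkDerivation_X, mkDerivation_X, derivation_C,
    linForm_self hq]
  simp

theorem natCast_mul_mem_iff [CharZero K] (I : Ideal (MvPolynomial σ K)) {e : ℕ} (he : e ≠ 0)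
    (F : MvPolynomial σ K) : (e : MvPolynomial σ K) * F ∈ I ↔ F ∈ I := by
  refine I.unit_mul_mem_iff_mem ?_
  have : IsUnit (e : K) := IsUnit.mk0 _ (Nat.cast_ne_zero.2 he)
  simpa using this.map (C : K →+* MvPolynomial σ K)

variable [Fintype σ]

theorem eulerDeriv_apply (q : σ → K) (k : σ) (F : MvPolynomial σ K) :
    eulerDeriv q k F = ∑ j, linForm q k j * pderiv j F := by
  classical
  have h : eulerDeriv q k = ∑ j, linForm q k j • pderiv j := by
    refine derivation_ext fun i => ?_
    rw [eulerDeriv, mkDerivation_X, ← Derivation.coeFnAddMonoidHom_apply, map_sum]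
    simp [pderiv_X, Pi.single_apply, Finset.sum_apply]
  rw [h, ← Derivation.coeFnAddMonoidHom_apply, map_sum]
  simp [Finset.sum_apply]

theorem eulerDeriv_mem (q : σ → K) (k : σ) (F : MvPolynomial σ K) :
    eulerDeriv q k F ∈ linIdeal q k := by
  rw [eulerDeriv_apply]
  exact sum_mem fun j _ => Ideal.mul_mem_right _ _ (linForm_mem q k j)

/-- Euler's identity on the associated graded ring of a point ideal. -/
theorem eulerDeriv_sub_mem {q : σ → K} {k : σ} (hq : q k = 1) (e : ℕ) :
    ∀ G ∈ linIdeal q k ^ e, eulerDeriv q k G - (e : MvPolynomial σ K) * G ∈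
      linIdeal q k ^ (e + 1) := by
  have h1 : ∀ G ∈ linIdeal q k, eulerDeriv q k G - G ∈ linIdeal q k ^ 2 := by
    intro G hG
    refine Submodule.span_induction ?_ ?_ ?_ ?_ hG
    · rintro _ ⟨j, rfl⟩
      simp [eulerDeriv_linForm hq]
    · simp
    · intro x y _ _ hx hy
      rw [map_add, add_sub_add_comm]
      exact add_mem hx hy
    · intro a y hy h
      rw [smul_eq_mul, Derivation.leibniz, smul_eq_mul, smul_eq_mul,
        show a * eulerDeriv q k y + y * eulerDeriv q k a - a * y =
          a * (eulerDeriv q k y - y) + y * eulerDeriv q k a by ring]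
      refine add_mem (Ideal.mul_mem_left _ _ h) ?_
      rw [pow_two]
      exact Ideal.mul_mem_mul hy (eulerDeriv_mem q k a)
  induction e with
  | zero => intro G _; simpa using eulerDeriv_mem q k G
  | succ e ih =>
    intro G hG
    rw [pow_succ] at hG
    refine Submodule.mul_induction_on hG (fun f hf g hg => ?_) (fun f g hf hg => ?_)
    · rw [Derivation.leibniz, smul_eq_mul, smul_eq_mul]
      have : f * eulerDeriv q k g + g * eulerDeriv q k f - ((e + 1 : ℕ) : MvPolynomial σ K) * (f * g)
          = f * (eulerDeriv q k g - g) + (eulerDeriv q k f - (e : MvPolynomial σ K) * f) * g := by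
        push_cast; ring
      rw [this]
      refine add_mem ?_ ?_
      · rw [show e + 1 + 1 = e + 2 from rfl, pow_add]
        exact Ideal.mul_mem_mul hf (h1 g hg)
      · rw [pow_succ _ (e + 1)]
        exact Ideal.mul_mem_mul (ih f hf) hg
    · rw [map_add, mul_add, add_sub_add_comm]
      exact add_mem hf hg

/-- The variable `X_k` is a nonzerodivisor modulo the powers of the ideal of a point outside the
hyperplane `X_k = 0`. -/
theorem mem_pow_of_X_mul_mem [CharZero K] {q : σ → K} {k : σ} (hq : q k = 1) (e : ℕ) :
    ∀ F, X k * F ∈ linIdeal q k ^ e → F ∈ linIdeal q k ^ e := by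
  induction e with
  | zero => simp
  | succ e ih =>
    intro F hF
    have hFe := ih F (Ideal.pow_le_pow_right e.le_succ hF)
    -- Euler's identity recovers only `e * F`, so `e = 0` needs primality instead.
    rcases Nat.eq_zero_or_pos e with rfl | he
    · rw [zero_add, pow_one] at hF ⊢
      exact ((isPrime_linIdeal hq).mem_or_mem hF).resolve_left (X_notMem_linIdeal hq)
    · have hE : eulerDeriv q k F ∈ linIdeal q k ^ (e + 1) := by
        rw [eulerDeriv_apply]
        refine sum_mem fun j _ => ?_
        -- For `j ≠ k`, `∂_j` commutes with multiplication by `X_k`, so induction applies to `∂_j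
        -- F`; the term `j = k` has coefficient zero.
        by_cases hj : j = k
        · subst hj; simp [linForm_self hq]
        · rw [pow_succ']
          refine Ideal.mul_mem_mul (linForm_mem q k j) (ih _ ?_)
          have := derivation_mem_pow (pderiv j) _ e _ hF
          rwa [Derivation.leibniz, pderiv_X_of_ne (Ne.symm hj), smul_zero, add_zero] at this
      have := sub_mem hE (eulerDeriv_sub_mem hq e F hFe)
      rw [sub_sub_cancel] at this
      exact (natCast_mul_mem_iff _ he.ne' F).1 this

theorem mem_pow_of_X_pow_mul_mem [CharZero K] {q : σ → K} {k : σ} (hq : q k = 1) (e r : ℕ)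
    (F : MvPolynomial σ K) (h : X k ^ r * F ∈ linIdeal q k ^ e) : F ∈ linIdeal q k ^ e := by
  induction r with
  | zero => simpa using h
  | succ r ih => exact ih (mem_pow_of_X_mul_mem hq e _ (by rwa [pow_succ', mul_assoc] at h))

end Euler

/-! ### Hilbert function of a power of a point ideal -/

section Dimension

variable {σ K : Type*} [Field K]

/-- Multiplication by `X_k ^ r` as a `K`-linear map. -/
noncomputable def mulXPow (k : σ) (r : ℕ) : MvPolynomial σ K →ₗ[K] MvPolynomial σ K :=
  LinearMap.mulLeft K (X k ^ r)

@[simp]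
theorem mulXPow_apply (k : σ) (r : ℕ) (F : MvPolynomial σ K) : mulXPow k r F = X k ^ r * F := rfl

/-- Expand each variable as `ℓ_j + q_j X_k`: every product except one purely in the `ℓ_j` contains a
factor `X_k`. -/
theorem homogeneousSubmodule_le_pow_sup (q : σ → K) (k : σ) (d : ℕ) :
    homogeneousSubmodule σ K (d + 1) ≤
      (linIdeal q k ^ (d + 1)).restrictScalars K ⊔
        (homogeneousSubmodule σ K d).map (mulXPow k 1) := by
  induction d with
  | zero =>
    rw [zero_add, homogeneousSubmodule_one_eq_span_X, Submodule.span_le]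
    rintro _ ⟨j, rfl⟩
    rw [SetLike.mem_coe, X_eq_linForm_add q k j, pow_one]
    refine add_mem (Submodule.mem_sup_left (linForm_mem q k j)) (Submodule.mem_sup_right ?_)
    exact ⟨C (q j), isHomogeneous_C _ _, by simp [mul_comm]⟩
  | succ d ih =>
    rw [← homogeneousSubmodule_one_pow, pow_succ, homogeneousSubmodule_one_pow, Submodule.mul_le]
    intro G hG a ha
    rw [homogeneousSubmodule_one_eq_span_X] at ha
    induction ha using Submodule.span_induction with
    | zero => simp
    | add x y _ _ hx hy => rw [mul_add]; exact add_mem hx hy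
    | smul c x _ hx => rw [mul_smul_comm]; exact Submodule.smul_mem _ _ hx
    | mem x hx =>
      obtain ⟨j, rfl⟩ := hx
      obtain ⟨H, hH, _, ⟨G', hG', rfl⟩, hsum⟩ := Submodule.mem_sup.1 (ih hG)
      have key : G * X j = H * linForm q k j +
          mulXPow k 1 (linForm q k j * G' + C (q j) * G) := by
        rw [X_eq_linForm_add q k j, mul_add]
        conv_lhs => enter [1]; rw [← hsum]
        simp only [mulXPow_apply]; ring
      rw [key]
      refine add_mem (Submodule.mem_sup_left ?_) (Submodule.mem_sup_right ⟨_, ?_, rfl⟩)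
      · rw [Submodule.restrictScalars_mem, pow_succ]
        exact Ideal.mul_mem_mul hH (linForm_mem q k j)
      · refine add_mem ?_ ?_
        · have := (isHomogeneous_linForm q k j).mul hG'
          rwa [add_comm] at this
        · exact IsHomogeneous.C_mul hG (q j)

theorem homogeneousSubmodule_le_pow_sup_map (q : σ → K) (k : σ) (d r : ℕ) :
    homogeneousSubmodule σ K (d + r) ≤
      (linIdeal q k ^ (d + 1)).restrictScalars K ⊔
        (homogeneousSubmodule σ K d).map (mulXPow k r) := by
  induction r with
  | zero => exact fun F hF => Submodule.mem_sup_right ⟨F, hF, by simp⟩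
  | succ r ih =>
    refine (homogeneousSubmodule_le_pow_sup q k (d + r)).trans (sup_le ?_ ?_)
    · exact le_sup_of_le_left (Ideal.pow_le_pow_right (by lia))
    · rintro _ ⟨G, hG, rfl⟩
      obtain ⟨H, hH, _, ⟨G', hG', rfl⟩, rfl⟩ := Submodule.mem_sup.1 (ih hG)
      rw [map_add]
      refine add_mem (Submodule.mem_sup_left (Ideal.mul_mem_left _ _ hH))
        (Submodule.mem_sup_right ⟨G', hG', ?_⟩)
      simp only [mulXPow_apply]; ring

instance finiteDimensional_homogeneousSubmodule [Finite σ] (i : ℕ) :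
    FiniteDimensional K (homogeneousSubmodule σ K i) :=
  Module.Finite.iff_fg.2 (homogeneousSubmodule_fg _ _ i)

theorem finrank_homogeneousSubmodule [Fintype σ] (i : ℕ) :
    Module.finrank K (homogeneousSubmodule σ K i) = (Fintype.card σ + i - 1).choose i := by
  classical
  have e : {d : σ →₀ ℕ | d.degree = i} ≃ (Finset.univ : Finset σ).finsuppAntidiag i :=
    Equiv.subtypeEquivRight fun d => by
      simp [Finset.mem_finsuppAntidiag, Finsupp.degree_eq_sum]
  have : Fintype {d : σ →₀ ℕ | d.degree = i} := Fintype.ofEquiv _ e.symm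
  rw [homogeneousSubmodule_eq_finsupp_supported,
    (AddMonoidAlgebra.supportedEquivFinsupp _).finrank_eq, Module.finrank_finsupp_self,
    Fintype.card_congr e, Fintype.card_coe, Finset.card_finsuppAntidiag_nat_eq_choose,
    Finset.card_univ]

/-- In degree `i`, for exponent `e + 1`, a complement of the power is `X_k^(i-e)` times the forms of
degree `e`. The intersection is zero: cancelling `X_k` would put a form of degree `e` into the
`(e+1)`-st power of the irrelevant ideal. -/
theorem finrank_homogeneousSubmodule_eq_add_choose [Fintype σ] [CharZero K] {q : σ → K} {k : σ}
    (hq : q k = 1) {n : ℕ} (hσ : Fintype.card σ = n + 1) (hn : 1 ≤ n) (e i : ℕ) (hi : e ≤ i) :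
    Module.finrank K (homogeneousSubmodule σ K i) =
      Module.finrank K ↥(homogeneousSubmodule σ K i ⊓ (linIdeal q k ^ e).restrictScalars K) +
        (e + n - 1).choose n := by
  rcases e with _ | e
  · have : (linIdeal q k ^ 0).restrictScalars K = ⊤ := by
      rw [pow_zero, Ideal.one_eq_top, Submodule.restrictScalars_top]
    rw [this, inf_top_eq, Nat.choose_eq_zero_of_lt (by lia), add_zero]
  · set A := homogeneousSubmodule σ K i ⊓ (linIdeal q k ^ (e + 1)).restrictScalars K
    set B := (homogeneousSubmodule σ K e).map (mulXPow k (i - e))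
    have hBle : B ≤ homogeneousSubmodule σ K i := by
      rintro _ ⟨G, hG, rfl⟩
      have := (isHomogeneous_X_pow (R := K) k (i - e)).mul hG
      rwa [show i - e + e = i by lia] at this
    have hsup : A ⊔ B = homogeneousSubmodule σ K i := by
      apply le_antisymm (sup_le inf_le_left hBle)
      intro F hF
      have h := homogeneousSubmodule_le_pow_sup_map q k e (i - e)
      rw [show e + (i - e) = i by lia] at h
      obtain ⟨H, hH, G, hG, rfl⟩ := Submodule.mem_sup.1 (h hF)
      refine add_mem (Submodule.mem_sup_left ⟨?_, hH⟩) (Submodule.mem_sup_right hG)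
      simpa using sub_mem hF (hBle hG)
    have hinf : A ⊓ B = ⊥ := by
      rw [eq_bot_iff]
      rintro _ ⟨⟨_, hI⟩, ⟨G, hG, rfl⟩⟩
      have hG' := Ideal.pow_right_mono (linIdeal_le_idealOfVars q k) _
        (mem_pow_of_X_pow_mul_mem hq _ _ _ hI)
      rw [mem_pow_idealOfVars_iff'] at hG'
      have : G = 0 := by
        ext a
        by_cases ha : a.degree = e
        · exact hG' a (by lia)
        · exact IsHomogeneous.coeff_eq_zero hG ha
      simp [this]
    have hinj : Function.Injective (mulXPow (K := K) k (i - e)) :=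
      mul_right_injective₀ (pow_ne_zero _ (X_ne_zero k))
    have hB : Module.finrank K B = (e + 1 + n - 1).choose n := by
      rw [← (Submodule.equivMapOfInjective _ hinj _).finrank_eq, finrank_homogeneousSubmodule, hσ,
        ← Nat.choose_symm_of_eq_add (show n + 1 + e - 1 = n + e by lia)]
      congr 1; lia
    have hA : FiniteDimensional K A := Submodule.finiteDimensional_of_le inf_le_left
    have hB' : FiniteDimensional K B := Submodule.finiteDimensional_of_le hBle
    have := Submodule.finrank_sup_add_finrank_inf_eq A B
    rw [hsup, hinf, finrank_bot, add_zero, hB] at this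
    exact this

end Dimension

/-! ### Distinct points: codimensions add -/

section Points

variable {K : Type*} [Field K] {n s : ℕ}

/-- Rescale a representative so that some nonzero coordinate becomes `1`; a form `F` of degree `d`
is then `F(q) X_k^d` modulo the linear forms. -/
theorem pointIdeal_eq_linIdeal (P : ℙ K (Fin (n + 1) → K)) :
    ∃ (k : Fin (n + 1)) (q : Fin (n + 1) → K) (c : K),
      q k = 1 ∧ c ≠ 0 ∧ P.rep = c • q ∧ pointIdeal P = linIdeal q k := by
  obtain ⟨k, hk⟩ := Function.ne_iff.1 P.rep_nonzero
  rw [Pi.zero_apply] at hk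
  have hrep : P.rep = P.rep k • ((P.rep k)⁻¹ • P.rep) := by rw [smul_inv_smul₀ hk]
  refine ⟨k, (P.rep k)⁻¹ • P.rep, P.rep k, by simp [hk], hk, hrep, le_antisymm ?_ ?_⟩
  · refine Ideal.span_le.2 ?_
    rintro F ⟨⟨d, hd⟩, hF⟩
    have h := sub_eval_mem_linIdeal ((P.rep k)⁻¹ • P.rep) k hd
    have h0 : eval ((P.rep k)⁻¹ • P.rep) F = 0 := by
      have h1 := aeval_mul_of_isHomogeneous hd P.rep (P.rep k)⁻¹
      rw [aeval_eq_eval, aeval_eq_eval] at h1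
      change eval (fun j => P.rep j * (P.rep k)⁻¹) F = eval P.rep F * _ at h1
      rw [hF, zero_mul] at h1
      rw [← h1]
      congr 2
      ext j
      simp [mul_comm]
    rwa [h0, C_0, zero_mul, sub_zero] at h
  · refine Ideal.span_le.2 ?_
    rintro _ ⟨j, rfl⟩
    refine Ideal.subset_span ⟨⟨1, isHomogeneous_linForm _ _ _⟩, ?_⟩
    simp [linForm]
    field_simp
    simp

attribute [local instance] MvPolynomial.gradedAlgebra

theorem isHomogeneous_pointIdeal_pow (P : ℙ K (Fin (n + 1) → K)) (e : ℕ) :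
    (pointIdeal P ^ e).IsHomogeneous (homogeneousSubmodule (Fin (n + 1)) K) := by
  induction e with
  | zero => rw [pow_zero, Ideal.one_eq_top]; exact Ideal.IsHomogeneous.top _
  | succ e ih =>
    rw [pow_succ]
    exact ih.mul (Ideal.homogeneous_span _ _ fun F hF => hF.1)

/-- Distinct points of projective space are disjoint. -/
theorem idealOfVars_le_of_pointIdeal_le {P Q : ℙ K (Fin (n + 1) → K)} (hPQ : P ≠ Q)
    {p : Ideal (MvPolynomial (Fin (n + 1)) K)} [p.IsPrime] (hP : pointIdeal P ≤ p)
    (hQ : pointIdeal Q ≤ p) : idealOfVars (Fin (n + 1)) K ≤ p := by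
  obtain ⟨k, q, c, hqk, hc, hrep, hI⟩ := pointIdeal_eq_linIdeal P
  obtain ⟨k', q', c', hqk', hc', hrep', hI'⟩ := pointIdeal_eq_linIdeal Q
  rw [hI] at hP
  rw [hI'] at hQ
  -- Some linear form through `Q` does not vanish at `P`. Modulo the ideal of `P` it is a nonzero
  -- multiple of `X_k`, which forces `X_k ∈ p`.
  have hj : ∃ j, eval q (linForm q' k' j) ≠ 0 := by
    by_contra! h
    apply hPQ
    rw [← P.mk_rep, ← Q.mk_rep, Projectivization.mk_eq_mk_iff']
    refine ⟨c * q k' * c'⁻¹, ?_⟩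
    ext j
    have := h j
    simp only [linForm, map_sub, map_mul, eval_X, eval_C, sub_eq_zero] at this
    simp only [hrep, hrep', Pi.smul_apply, smul_eq_mul, this]
    field_simp
  obtain ⟨j, hj⟩ := hj
  refine idealOfVars_le_of_linIdeal_le hP ?_
  have h1 := hP (sub_eval_mem_linIdeal q k (isHomogeneous_linForm q' k' j))
  have h2 := sub_mem (hQ (linForm_mem q' k' j)) h1
  rw [sub_sub_cancel, pow_one] at h2
  exact (p.unit_mul_mem_iff_mem ((IsUnit.mk0 _ hj).map C)).1 h2

theorem homogeneousSubmodule_le_idealOfVars_pow {σ : Type*} {N i : ℕ} (h : N ≤ i) :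
    homogeneousSubmodule σ K i ≤ (idealOfVars σ K ^ N).restrictScalars K := by
  intro F hF
  rw [Submodule.restrictScalars_mem, mem_pow_idealOfVars_iff']
  exact fun a ha => IsHomogeneous.coeff_eq_zero hF (by lia)

theorem exists_idealOfVars_pow_le {σ : Type*} [Finite σ] (J : Ideal (MvPolynomial σ K))
    (h : ∀ p : Ideal (MvPolynomial σ K), p.IsPrime → J ≤ p → idealOfVars σ K ≤ p) :
    ∃ N, idealOfVars σ K ^ N ≤ J := by
  refine Ideal.exists_pow_le_of_le_radical_of_fg ?_ (idealOfVars_fg σ K)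
  rw [Ideal.radical_eq_sInf]
  exact le_sInf fun p hp => h p hp.2 hp.1

/-- The Hilbert function of an intersection of two homogeneous ideals whose sum is irrelevant. -/
theorem finrank_inf_add_eventually {σ : Type*} [Finite σ] {I J : Ideal (MvPolynomial σ K)}
    (hI : I.IsHomogeneous (homogeneousSubmodule σ K))
    (hJ : J.IsHomogeneous (homogeneousSubmodule σ K)) {N : ℕ}
    (hN : idealOfVars σ K ^ N ≤ I ⊔ J) {i : ℕ} (hi : N ≤ i) :
    Module.finrank K ↥(homogeneousSubmodule σ K i ⊓ (I ⊓ J).restrictScalars K) +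
        Module.finrank K (homogeneousSubmodule σ K i) =
      Module.finrank K ↥(homogeneousSubmodule σ K i ⊓ I.restrictScalars K) +
        Module.finrank K ↥(homogeneousSubmodule σ K i ⊓ J.restrictScalars K) := by
  set S := homogeneousSubmodule σ K i
  set A := S ⊓ I.restrictScalars K
  set B := S ⊓ J.restrictScalars K
  have hA : FiniteDimensional K A := Submodule.finiteDimensional_of_le inf_le_left
  have hB : FiniteDimensional K B := Submodule.finiteDimensional_of_le inf_le_left
  have hinf : S ⊓ (I ⊓ J).restrictScalars K = A ⊓ B := by
    ext F
    simp only [A, B, Submodule.mem_inf, Submodule.restrictScalars_mem]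
    tauto
  have hsup : S = A ⊔ B := by
    refine le_antisymm (fun F hF => ?_) (sup_le inf_le_left inf_le_left)
    obtain ⟨G, hG, H, hH, hGH⟩ :=
      Submodule.mem_sup.1 (hN (homogeneousSubmodule_le_idealOfVars_pow hi hF))
    rw [← homogeneousComponent_eq_self hF, ← hGH, map_add]
    exact add_mem
      (Submodule.mem_sup_left
        ⟨homogeneousComponent_mem _ _, homogeneousComponent_mem_of_mem hI hG i⟩)
      (Submodule.mem_sup_right
        ⟨homogeneousComponent_mem _ _, homogeneousComponent_mem_of_mem hJ hH i⟩)
  have := Submodule.finrank_sup_add_finrank_inf_eq A B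
  rw [← hsup, ← hinf] at this
  lia

/-- Points are added one at a time: a prime over both the new power and the previous intersection
contains the ideals of two distinct points, hence all variables. -/
theorem finrank_homogeneousSubmodule_eq_add_sum [CharZero K] (hn : 1 ≤ n)
    (P : Fin s → ℙ K (Fin (n + 1) → K)) (hP : Function.Injective P) (e : Fin s → ℕ)
    (t : Finset (Fin s)) :
    ∀ᶠ i in Filter.atTop, Module.finrank K (homogeneousSubmodule (Fin (n + 1)) K i) =
      Module.finrank K ↥(homogeneousSubmodule (Fin (n + 1)) K i ⊓
        (t.inf fun j => pointIdeal (P j) ^ e j).restrictScalars K) +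
      ∑ j ∈ t, (e j + n - 1).choose n := by
  classical
  induction t using Finset.induction_on with
  | empty =>
    refine Filter.Eventually.of_forall fun i => ?_
    rw [Finset.inf_empty, Submodule.restrictScalars_top, inf_top_eq, Finset.sum_empty, add_zero]
  | insert a t ha ih =>
    have hhom : (t.inf fun j => pointIdeal (P j) ^ e j).IsHomogeneous
        (homogeneousSubmodule (Fin (n + 1)) K) :=
      Finset.inf_induction (Ideal.IsHomogeneous.top _) (fun _ h₁ _ h₂ => h₁.inf h₂)
        fun j _ => isHomogeneous_pointIdeal_pow (P j) (e j)
    obtain ⟨N, hN⟩ := exists_idealOfVars_pow_le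
      (pointIdeal (P a) ^ e a ⊔ t.inf fun j => pointIdeal (P j) ^ e j) (by
        intro p hp hle
        obtain ⟨j, hj, hle'⟩ := hp.inf_le'.1 (le_sup_right.trans hle)
        refine idealOfVars_le_of_pointIdeal_le (P := P a) (Q := P j) (p := p) ?_
          (Ideal.IsPrime.le_of_pow_le (le_sup_left.trans hle)) (Ideal.IsPrime.le_of_pow_le hle')
        exact fun h => ha (hP h ▸ hj))
    filter_upwards [ih, Filter.eventually_ge_atTop N, Filter.eventually_ge_atTop (e a)]
      with i hi hiN hie
    have h1 := finrank_inf_add_eventually (isHomogeneous_pointIdeal_pow (P a) (e a)) hhom hN hiN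
    obtain ⟨k, q, c, hqk, hc, hrep, hI⟩ := pointIdeal_eq_linIdeal (P a)
    have h2 := finrank_homogeneousSubmodule_eq_add_choose hqk (Fintype.card_fin (n + 1)) hn
      (e a) i hie
    rw [← hI] at h2
    rw [Finset.inf_insert, Finset.sum_insert ha]
    lia

end Points

/-! ### The ideal of derivatives -/

section DerivIdeal

variable {σ K : Type*} [Field K]

/-- The ideal generated by `I` and all partial derivatives of its elements. -/
noncomputable def derivIdeal (I : Ideal (MvPolynomial σ K)) : Ideal (MvPolynomial σ K) :=
  I ⊔ Ideal.span {G | ∃ F ∈ I, ∃ l, G = pderiv l F}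

theorem le_derivIdeal (I : Ideal (MvPolynomial σ K)) : I ≤ derivIdeal I := le_sup_left

theorem pderiv_mem_derivIdeal {I : Ideal (MvPolynomial σ K)} {F : MvPolynomial σ K} (hF : F ∈ I)
    (l : σ) : pderiv l F ∈ derivIdeal I :=
  Ideal.mem_sup_right (Ideal.subset_span ⟨F, hF, l, rfl⟩)

theorem derivIdeal_le {I J : Ideal (MvPolynomial σ K)} :
    derivIdeal I ≤ J ↔ I ≤ J ∧ ∀ F ∈ I, ∀ l, pderiv l F ∈ J := by
  rw [derivIdeal, sup_le_iff, Ideal.span_le]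
  refine and_congr_right fun _ => ⟨fun h F hF l => h ⟨F, hF, l, rfl⟩, ?_⟩
  rintro h _ ⟨F, hF, l, rfl⟩
  exact h F hF l

/-- This stands in for localisation at `Q`: the second factor `Q` absorbs the term `F ∂_l Q` of the
product rule. -/
theorem sq_mul_mem_derivIdeal {I J : Ideal (MvPolynomial σ K)} {Q : MvPolynomial σ K}
    (hQ : ∀ F ∈ I, Q * F ∈ J) {G : MvPolynomial σ K} (hG : G ∈ derivIdeal I) :
    Q ^ 2 * G ∈ derivIdeal J := by
  suffices h : derivIdeal I ≤ Submodule.comap (LinearMap.mulLeft (MvPolynomial σ K) (Q ^ 2))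
      (derivIdeal J : Submodule (MvPolynomial σ K) (MvPolynomial σ K)) from h hG
  refine derivIdeal_le.2 ⟨fun F hF => ?_, fun F hF l => ?_⟩
  · change Q ^ 2 * F ∈ derivIdeal J
    rw [pow_two, mul_assoc]
    exact Ideal.mul_mem_left _ _ (le_derivIdeal _ (hQ F hF))
  · change Q ^ 2 * pderiv l F ∈ derivIdeal J
    have h : Q ^ 2 * pderiv l F = Q * pderiv l (Q * F) - pderiv l Q * (Q * F) := by
      rw [Derivation.leibniz, smul_eq_mul, smul_eq_mul]; ring
    rw [h]
    exact sub_mem (Ideal.mul_mem_left _ _ (pderiv_mem_derivIdeal (hQ F hF) l))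
      (Ideal.mul_mem_left _ _ (le_derivIdeal _ (hQ F hF)))

theorem linIdeal_pow_le_derivIdeal [CharZero K] [Fintype σ] {q : σ → K} {k : σ} (hq : q k = 1)
    {n : ℕ} (hσ : Fintype.card σ = n + 1) (hn : 1 ≤ n) (e : ℕ) :
    linIdeal q k ^ e ≤ derivIdeal (linIdeal q k ^ (e + 1)) := by
  classical
  intro G hG
  have h1 : ∑ j, pderiv j (linForm q k j * G) ∈ derivIdeal (linIdeal q k ^ (e + 1)) := by
    refine sum_mem fun j _ => pderiv_mem_derivIdeal ?_ j
    rw [pow_succ']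
    exact Ideal.mul_mem_mul (linForm_mem q k j) hG
  have h2 : ∑ j, pderiv j (linForm q k j * G) = (n : MvPolynomial σ K) * G + eulerDeriv q k G := by
    have h3 : ∑ j, pderiv j (linForm q k j) = (n : MvPolynomial σ K) := by
      simp [linForm, pderiv_X, Pi.single_apply, hσ, hq, Finset.sum_sub_distrib]
    simp only [Derivation.leibniz, smul_eq_mul, Finset.sum_add_distrib, ← Finset.mul_sum, h3,
      ← eulerDeriv_apply]
    ring
  have h3 := le_derivIdeal _ (eulerDeriv_sub_mem hq e G hG)
  rw [h2] at h1
  have h4 := sub_mem h1 h3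
  rw [show (n : MvPolynomial σ K) * G + eulerDeriv q k G - (eulerDeriv q k G - e * G) =
    ((n + e : ℕ) : MvPolynomial σ K) * G by push_cast; ring] at h4
  exact (natCast_mul_mem_iff _ (by lia) G).1 h4

end DerivIdeal

/-! ### Comparison with the ideal of the slimming -/

section Slimming

variable {K : Type*} [Field K] {n s : ℕ}

theorem derivIdeal_fatPointIdeal_le (P : Fin s → ℙ K (Fin (n + 1) → K)) (m : Fin s → ℕ)
    (hm : ∀ j, 1 ≤ m j) :
    derivIdeal (fatPointIdeal P m) ≤ fatPointIdeal P (fun j => m j - 1) := by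
  refine derivIdeal_le.2 ⟨iInf_mono fun j => Ideal.pow_le_pow_right (Nat.sub_le _ _), ?_⟩
  intro F hF l
  refine (Submodule.mem_iInf _).2 fun j => derivation_mem_pow _ _ _ _ ?_
  rw [Nat.sub_add_cancel (hm j)]
  exact (Submodule.mem_iInf _).1 hF j

theorem exists_idealOfVars_pow_mul_le [CharZero K] (hn : 1 ≤ n)
    (P : Fin s → ℙ K (Fin (n + 1) → K)) (hP : Function.Injective P) (m : Fin s → ℕ)
    (hm : ∀ j, 1 ≤ m j) :
    ∃ N, ∀ F ∈ idealOfVars (Fin (n + 1)) K ^ N, ∀ G ∈ fatPointIdeal P (fun j => m j - 1),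
      F * G ∈ derivIdeal (fatPointIdeal P m) := by
  classical
  set J := derivIdeal (fatPointIdeal P m)
  set Y := fatPointIdeal P (fun j => m j - 1)
  obtain ⟨N, hN⟩ := exists_idealOfVars_pow_le (Submodule.colon J (Y : Set _)) (by
    intro p hp hle
    have hW : fatPointIdeal P m ≤ p := fun F hF => hle <| Submodule.mem_colon.2 fun G _ =>
      Ideal.mul_mem_right _ _ (le_derivIdeal _ hF)
    rw [fatPointIdeal, ← Finset.inf_univ_eq_iInf] at hW
    obtain ⟨j, -, hj⟩ := hp.inf_le'.1 hW
    -- Either `p` lies over a second point, or some `Q ∉ p` lies in the powers at all other points;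
    -- then `Q^2` is in the colon ideal, a contradiction.
    by_cases hk : (Finset.univ.erase j).inf (fun k => pointIdeal (P k) ^ m k) ≤ p
    · obtain ⟨k, hk, hkp⟩ := hp.inf_le'.1 hk
      exact idealOfVars_le_of_pointIdeal_le (P := P j) (Q := P k) (p := p)
        (fun h => Finset.ne_of_mem_erase hk (hP h).symm) (Ideal.IsPrime.le_of_pow_le hj)
        (Ideal.IsPrime.le_of_pow_le hkp)
    · obtain ⟨Q, hQ, hQp⟩ := SetLike.not_le_iff_exists.1 hk
      refine absurd (hp.mem_of_pow_mem 2 (hle <| Submodule.mem_colon.2 fun G hG => ?_)) hQp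
      refine sq_mul_mem_derivIdeal (I := pointIdeal (P j) ^ m j) (fun F hF => ?_) ?_
      · refine (Submodule.mem_iInf _).2 fun k => ?_
        by_cases hkj : k = j
        · exact hkj ▸ Ideal.mul_mem_left _ _ hF
        · exact Ideal.mul_mem_right _ _ (Finset.inf_le
            (f := fun k => pointIdeal (P k) ^ m k) (Finset.mem_erase.2 ⟨hkj, Finset.mem_univ k⟩) hQ)
      · obtain ⟨k, q, c, hqk, hc, hrep, hI⟩ := pointIdeal_eq_linIdeal (P j)
        have hGj : G ∈ pointIdeal (P j) ^ (m j - 1) := (Submodule.mem_iInf _).1 hG j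
        have h := linIdeal_pow_le_derivIdeal hqk (Fintype.card_fin (n + 1)) hn (m j - 1)
        rw [← hI, Nat.sub_add_cancel (hm j)] at h
        exact h hGj)
  exact ⟨N, fun F hF G hG => Submodule.mem_colon.1 (hN hF) G hG⟩

/-- In large degrees, the ideal of the slimming consists of the derivatives of the ideal. -/
theorem homogeneousSubmodule_inf_derivIdeal_eventually [CharZero K] (hn : 1 ≤ n)
    (P : Fin s → ℙ K (Fin (n + 1) → K)) (hP : Function.Injective P) (m : Fin s → ℕ)
    (hm : ∀ j, 1 ≤ m j) :
    ∀ᶠ i in Filter.atTop,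
      homogeneousSubmodule (Fin (n + 1)) K i ⊓
          (derivIdeal (fatPointIdeal P m)).restrictScalars K =
        homogeneousSubmodule (Fin (n + 1)) K i ⊓
          (fatPointIdeal P (fun j => m j - 1)).restrictScalars K := by
  obtain ⟨N, hN⟩ := exists_idealOfVars_pow_mul_le hn P hP m hm
  obtain ⟨c, hc⟩ := Ideal.exists_pow_inf_eq_pow_smul (idealOfVars (Fin (n + 1)) K)
    (fatPointIdeal P (fun j => m j - 1))
  filter_upwards [Filter.eventually_ge_atTop (c + N)] with i hi
  refine le_antisymm (inf_le_inf_left _ (derivIdeal_fatPointIdeal_le P m hm)) ?_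
  rintro F ⟨hF, hFY⟩
  refine ⟨hF, ?_⟩
  have h : F ∈ idealOfVars (Fin (n + 1)) K ^ (c + N) • (⊤ : Ideal _) ⊓
      fatPointIdeal P (fun j => m j - 1) := by
    refine ⟨?_, hFY⟩
    rw [smul_eq_mul, Ideal.mul_top]
    exact homogeneousSubmodule_le_idealOfVars_pow hi hF
  -- Artin–Rees leaves `N` factors of the irrelevant ideal times elements of the slimming's ideal.
  rw [hc _ (Nat.le_add_right c N), Nat.add_sub_cancel_left] at h
  refine Submodule.smul_induction_on h (fun a ha b hb => ?_) fun x y hx hy => add_mem hx hy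
  exact hN a ha b hb.2

end Slimming

/-- The value of an alternating map on linear combinations of as many vectors as it has
arguments. -/
theorem alternatingMap_sum_smul {R M N ι : Type*} [CommRing R] [AddCommGroup M] [Module R M]
    [AddCommGroup N] [Module R N] [Fintype ι] [DecidableEq ι] (f : M [⋀^ι]→ₗ[R] N) (v : ι → M)
    (A : Matrix ι ι R) : f (fun i => ∑ j, A i j • v j) = A.det • f v := by
  have h : f.compLinearMap (Fintype.linearCombination R v) =
      (LinearMap.toSpanSingleton R N (f v)).compAlternatingMap Matrix.detRowAlternating := by
    refine Module.Basis.ext_alternating (Pi.basisFun R ι) fun i hi => ?_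
    let π : Equiv.Perm ι := Equiv.ofBijective i (Finite.injective_iff_bijective.1 hi)
    have h1 : (fun j => Pi.basisFun R ι (i j)) = (fun j => Pi.basisFun R ι j) ∘ π := rfl
    have h2 : Matrix.detRowAlternating (fun j => Pi.basisFun R ι j) = (1 : R) := by
      rw [← Matrix.det_one (n := ι)]
      change Matrix.det _ = _
      congr 1
      ext a b
      simp [Matrix.one_apply, Pi.single_apply, eq_comm]
    rw [h1, AlternatingMap.map_perm, AlternatingMap.map_perm]
    rw [LinearMap.compAlternatingMap_apply, h2, LinearMap.toSpanSingleton_apply, one_smul]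
    congr 1
    simp only [AlternatingMap.compLinearMap_apply]
    congr 1
    ext1 j
    simp
  exact DFunLike.congr_fun h A

/-! ### Top differential forms and the volume form -/

section TopForms

variable {K : Type*} [Field K] {N : ℕ} (I : Ideal (MvPolynomial (Fin N) K))

theorem D_mk_eq_sum (F : MvPolynomial (Fin N) K) :
    KaehlerDifferential.D K (MvPolynomial (Fin N) K ⧸ I) (Ideal.Quotient.mk I F) =
      ∑ l, Ideal.Quotient.mk I (pderiv l F) •
        KaehlerDifferential.D K (MvPolynomial (Fin N) K ⧸ I) (Ideal.Quotient.mk I (X l)) := by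
  have h := (KaehlerDifferential.mvPolynomialBasis K (Fin N)).sum_repr
    (KaehlerDifferential.D K (MvPolynomial (Fin N) K) F)
  have h2 := congrArg
    (KaehlerDifferential.map K K (MvPolynomial (Fin N) K) (MvPolynomial (Fin N) K ⧸ I)) h
  rw [KaehlerDifferential.map_D, map_sum] at h2
  rw [← Ideal.Quotient.algebraMap_eq, ← h2]
  refine Finset.sum_congr rfl fun l _ => ?_
  rw [map_smul, KaehlerDifferential.mvPolynomialBasis_repr_apply,
    KaehlerDifferential.mvPolynomialBasis_apply, KaehlerDifferential.map_D]
  rfl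

/-- The form `dx₁ ∧ ⋯ ∧ dx_N`. -/
noncomputable def volForm : KaehlerForms K (MvPolynomial (Fin N) K ⧸ I) N :=
  exteriorPower.ιMulti _ N fun j =>
    KaehlerDifferential.D K (MvPolynomial (Fin N) K ⧸ I) (Ideal.Quotient.mk I (X j))

/-- The `K`-linear map `F ↦ F dx₁ ∧ ⋯ ∧ dx_N`. -/
noncomputable def volMap :
    MvPolynomial (Fin N) K →ₗ[K] KaehlerForms K (MvPolynomial (Fin N) K ⧸ I) N :=
  ((LinearMap.toSpanSingleton (MvPolynomial (Fin N) K ⧸ I) _ (volForm I)).restrictScalars K).comp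
    (Ideal.Quotient.mkₐ K I).toLinearMap

theorem volMap_apply (F : MvPolynomial (Fin N) K) :
    volMap I F = Ideal.Quotient.mk I F • volForm I := rfl

theorem ιMulti_D_mk (G : Fin N → MvPolynomial (Fin N) K) :
    exteriorPower.ιMulti (MvPolynomial (Fin N) K ⧸ I) N
        (fun j => KaehlerDifferential.D K _ (Ideal.Quotient.mk I (G j))) =
      volMap I (Matrix.det (Matrix.of fun j l => pderiv l (G j))) := by
  rw [volMap_apply, RingHom.map_det, volForm, ← alternatingMap_sum_smul]
  congr 1
  ext1 j
  exact D_mk_eq_sum I (G j)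

theorem volMap_eq_zero_of_mem {F : MvPolynomial (Fin N) K} (hF : F ∈ derivIdeal I) :
    volMap I F = 0 := by
  suffices h : derivIdeal I ≤ Ideal.comap (Ideal.Quotient.mk I)
      (LinearMap.ker (LinearMap.toSpanSingleton (MvPolynomial (Fin N) K ⧸ I) _ (volForm I)))
    from h hF
  refine derivIdeal_le.2 ⟨fun F hF => ?_, fun F hF l => ?_⟩
  · rw [Ideal.mem_comap, Ideal.Quotient.eq_zero_iff_mem.2 hF]
    exact zero_mem _
  · change Ideal.Quotient.mk I (pderiv l F) • volForm I = 0
    set v : Fin N → Ω[MvPolynomial (Fin N) K ⧸ I⁄K] := fun j =>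
      KaehlerDifferential.D K (MvPolynomial (Fin N) K ⧸ I) (Ideal.Quotient.mk I (X j))
    have h0 : ∑ j, Ideal.Quotient.mk I (pderiv j F) • v j = 0 := by
      rw [← D_mk_eq_sum, Ideal.Quotient.eq_zero_iff_mem.2 hF, map_zero]
    -- Put `∑ ∂_j F dx_j = 0` in slot `l` of the volume form: every term `j ≠ l` repeats a factor,
    -- leaving `∂_l F` times the form.
    have h1 := (exteriorPower.ιMulti (MvPolynomial (Fin N) K ⧸ I) N).map_update_zero v l
    rw [← h0, AlternatingMap.map_update_sum, Finset.sum_eq_single l] at h1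
    · rwa [AlternatingMap.map_update_smul, Function.update_eq_self] at h1
    · intro j _ hj
      rw [AlternatingMap.map_update_smul, AlternatingMap.map_update_self _ _ hj.symm, smul_zero]
    · simp

/-- The gradient, as a derivation on `K[X] / I`. -/
theorem exists_gradient_derivation {T : Type*} [CommRing T] [Algebra K T]
    [Algebra (MvPolynomial (Fin N) K ⧸ I) T] [IsScalarTower K (MvPolynomial (Fin N) K ⧸ I) T]
    (hT : ∀ F ∈ I, ∀ l, algebraMap (MvPolynomial (Fin N) K ⧸ I) T
      (Ideal.Quotient.mk I (pderiv l F)) = 0) :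
    ∃ δ : Derivation K (MvPolynomial (Fin N) K ⧸ I) (Fin N → T), ∀ F l,
      δ (Ideal.Quotient.mk I F) l =
        algebraMap (MvPolynomial (Fin N) K ⧸ I) T (Ideal.Quotient.mk I (pderiv l F)) := by
  obtain ⟨g, hg⟩ : ∃ g : MvPolynomial (Fin N) K ⧸ I → Fin N → T,
      ∀ F l, g (Ideal.Quotient.mk I F) l =
        algebraMap (MvPolynomial (Fin N) K ⧸ I) T (Ideal.Quotient.mk I (pderiv l F)) := by
    have hsurj : Function.Surjective (Ideal.Quotient.mk I) := Ideal.Quotient.mk_surjective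
    refine ⟨fun r l => algebraMap _ T
      (Ideal.Quotient.mk I (pderiv l (Function.surjInv hsurj r))), fun F l => ?_⟩
    -- Two representatives differ by an element of `I`, whose gradient dies in `T`.
    rw [← sub_eq_zero, ← map_sub, ← map_sub, ← map_sub]
    exact hT _ (Ideal.Quotient.eq.1 (Function.surjInv_eq hsurj _)) l
  refine ⟨Derivation.mk' { toFun := g, map_add' := ?_, map_smul' := ?_ } ?_, hg⟩
  · intro a b
    obtain ⟨a, rfl⟩ := Ideal.Quotient.mk_surjective a
    obtain ⟨b, rfl⟩ := Ideal.Quotient.mk_surjective b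
    ext1 l
    rw [← map_add, Pi.add_apply, hg, hg, hg, map_add, map_add, map_add]
  · intro c a
    obtain ⟨a, rfl⟩ := Ideal.Quotient.mk_surjective a
    ext1 l
    have h (F) : c • Ideal.Quotient.mk I F = Ideal.Quotient.mk I (c • F) := rfl
    rw [h, Pi.smul_apply, hg, hg, Derivation.map_smul, ← h, RingHom.id_apply,
      Algebra.algebraMap_eq_smul_one, Algebra.algebraMap_eq_smul_one, smul_assoc]
  · intro a b
    obtain ⟨a, rfl⟩ := Ideal.Quotient.mk_surjective a
    obtain ⟨b, rfl⟩ := Ideal.Quotient.mk_surjective b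
    ext1 l
    change g _ l = (Ideal.Quotient.mk I a • g _ + Ideal.Quotient.mk I b • g _) l
    rw [← map_mul, Pi.add_apply, Pi.smul_apply, Pi.smul_apply, hg, hg, hg, Derivation.leibniz,
      smul_eq_mul, smul_eq_mul, Algebra.smul_def, Algebra.smul_def]
    simp only [map_add, map_mul]

/-- The determinant of the values of a linear map with values in a free module over an algebra. -/
theorem exists_alternatingMap_det {R T M ι : Type*} [CommRing R] [CommRing T] [Algebra R T]
    [AddCommGroup M] [Module R M] [Fintype ι] [DecidableEq ι] (φ : M →ₗ[R] ι → T) :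
    ∃ f : M [⋀^ι]→ₗ[R] T, ∀ v, f v = Matrix.det (Matrix.of fun i => φ (v i)) :=
  ⟨{ ((Matrix.detRowAlternating (R := T) (n := ι)).toMultilinearMap.restrictScalars
        R).compLinearMap (fun _ => φ) with
      map_eq_zero_of_eq' := fun _ _ _ hij hne =>
        Matrix.detRowAlternating.map_eq_zero_of_eq _ (congrArg φ hij) hne }, fun _ => rfl⟩

/-- The determinant of gradients is a linear functional on top forms with values in `T`, sending the
volume form to `1`. -/
theorem algebraMap_eq_zero_of_volMap_eq_zero {T : Type*} [CommRing T] [Algebra K T]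
    [Algebra (MvPolynomial (Fin N) K ⧸ I) T] [IsScalarTower K (MvPolynomial (Fin N) K ⧸ I) T]
    (hT : ∀ F ∈ I, ∀ l, algebraMap (MvPolynomial (Fin N) K ⧸ I) T
      (Ideal.Quotient.mk I (pderiv l F)) = 0)
    {F : MvPolynomial (Fin N) K} (hF : volMap I F = 0) :
    algebraMap (MvPolynomial (Fin N) K ⧸ I) T (Ideal.Quotient.mk I F) = 0 := by
  obtain ⟨δ, hδ⟩ := exists_gradient_derivation I hT
  obtain ⟨f, hf⟩ := exists_alternatingMap_det δ.liftKaehlerDifferential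
  have h1 : exteriorPower.alternatingMapLinearEquiv f (volForm I) = 1 := by
    rw [volForm, exteriorPower.alternatingMapLinearEquiv_apply_ιMulti, hf,
      ← Matrix.det_one (n := Fin N)]
    congr 1
    ext a b
    rw [Matrix.of_apply, Derivation.liftKaehlerDifferential_comp_D, hδ, pderiv_X,
      Matrix.one_apply, Pi.single_apply]
    split_ifs <;> simp_all
  have h2 := congrArg (exteriorPower.alternatingMapLinearEquiv f) hF
  rwa [volMap_apply, map_smul, h1, map_zero, Algebra.smul_def, mul_one] at h2

theorem mem_of_volMap_eq_zero {F : MvPolynomial (Fin N) K} (hF : volMap I F = 0) :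
    F ∈ derivIdeal I := by
  let π := Ideal.Quotient.factorₐ K (le_derivIdeal I)
  let : Algebra (MvPolynomial (Fin N) K ⧸ I) (MvPolynomial (Fin N) K ⧸ derivIdeal I) :=
    π.toRingHom.toAlgebra
  have : IsScalarTower K (MvPolynomial (Fin N) K ⧸ I) (MvPolynomial (Fin N) K ⧸ derivIdeal I) :=
    IsScalarTower.of_algebraMap_eq fun c => (π.commutes c).symm
  have hmem (G : MvPolynomial (Fin N) K) : algebraMap (MvPolynomial (Fin N) K ⧸ I)
      (MvPolynomial (Fin N) K ⧸ derivIdeal I) (Ideal.Quotient.mk I G) = 0 ↔ G ∈ derivIdeal I :=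
    Ideal.Quotient.eq_zero_iff_mem
  exact (hmem F).1 (algebraMap_eq_zero_of_volMap_eq_zero I
    (fun G hG l => (hmem _).2 (pderiv_mem_derivIdeal hG l)) hF)

theorem ker_volMap : LinearMap.ker (volMap I) = (derivIdeal I).restrictScalars K :=
  Submodule.ext fun _ => ⟨mem_of_volMap_eq_zero I, volMap_eq_zero_of_mem I⟩

/-- The homogeneous components of the module of top forms. -/
theorem kaehlerFormsComponent_le (i : ℕ) :
    kaehlerFormsComponent (fun d => (homogeneousSubmodule (Fin N) K d).map
        (Ideal.Quotient.mkₐ K I).toLinearMap) N i ≤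
      (homogeneousSubmodule (Fin N) K (i - N)).map (volMap I) := by
  refine Submodule.span_le.2 ?_
  rintro _ ⟨a, b, _, g, ⟨f, hf, rfl⟩, hg, hi, rfl⟩
  choose G hG hGg using hg
  obtain rfl : (fun j => Ideal.Quotient.mk I (G j)) = g := funext hGg
  rw [SetLike.mem_coe, ιMulti_D_mk]
  refine ⟨f * Matrix.det (Matrix.of fun j l => pderiv l (G j)), ?_, ?_⟩
  · by_cases hb : ∃ j, b j = 0
    · obtain ⟨j, hj⟩ := hb
      rw [Matrix.det_eq_zero_of_row_eq_zero j, mul_zero]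
      · exact zero_mem _
      · intro l
        have h0 := hG j
        rw [hj, SetLike.mem_coe, mem_homogeneousSubmodule, ← totalDegree_zero_iff_isHomogeneous,
          totalDegree_eq_zero_iff_eq_C] at h0
        rw [Matrix.of_apply, h0, pderiv_C]
    · push Not at hb
      have hsum : ∑ j, (b j - 1) + N = ∑ j, b j := by
        conv_lhs => enter [2]; rw [← Fintype.card_fin N, ← Finset.card_univ, Finset.card_eq_sum_ones]
        rw [← Finset.sum_add_distrib]
        exact Finset.sum_congr rfl fun j _ => Nat.sub_add_cancel (Nat.one_le_iff_ne_zero.2 (hb j))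
      rw [show i - N = a + ∑ j, (b j - 1) by lia]
      refine IsHomogeneous.mul hf ?_
      rw [Matrix.det_apply]
      refine IsHomogeneous.sum _ _ _ fun π _ => ?_
      rw [← mem_homogeneousSubmodule, Units.smul_def]
      refine zsmul_mem ?_ _
      rw [← Equiv.sum_comp π]
      exact IsHomogeneous.prod _ _ _ fun j _ => IsHomogeneous.pderiv (hG (π j))
  · rw [volMap_apply, volMap_apply, map_mul]
    exact mul_smul (Ideal.Quotient.mk I f) _ (volForm I)

theorem le_kaehlerFormsComponent (i : ℕ) :
    (homogeneousSubmodule (Fin N) K i).map (volMap I) ≤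
      kaehlerFormsComponent (fun d => (homogeneousSubmodule (Fin N) K d).map
        (Ideal.Quotient.mkₐ K I).toLinearMap) N (i + N) := by
  rintro _ ⟨F, hF, rfl⟩
  refine Submodule.subset_span ⟨i, fun _ => 1, Ideal.Quotient.mk I F,
    fun j => Ideal.Quotient.mk I (X j), ⟨F, hF, rfl⟩, fun j => ⟨X j, isHomogeneous_X _ _, rfl⟩,
    by simp, rfl⟩

end TopForms

/-- Rank-nullity for the restriction of a linear map to a subspace. -/
theorem finrank_map_add_finrank_inf_ker {K V W : Type*} [Field K] [AddCommGroup V] [Module K V]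
    [AddCommGroup W] [Module K W] (f : V →ₗ[K] W) (S : Submodule K V) [FiniteDimensional K S] :
    Module.finrank K (S.map f) + Module.finrank K ↥(S ⊓ LinearMap.ker f) =
      Module.finrank K S := by
  have h := LinearMap.finrank_range_add_finrank_ker (f.domRestrict S)
  rwa [LinearMap.range_domRestrict, LinearMap.ker_domRestrict,
    ← Submodule.finrank_map_subtype_eq, Submodule.map_comap_subtype] at h

end FatPoints

/-! ### Equality of the Hilbert polynomials -/

open FatPoints MvPolynomial in
theorem theorem3p7 {K : Type*} [Field K] [CharZero K] {n s : ℕ} (hn : 1 ≤ n)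
    (P : Fin s → ℙ K (Fin (n + 1) → K)) (hP : Function.Injective P)
    (m : Fin s → ℕ) (hm : ∀ j, 1 ≤ m j) :
    ∃ p : Polynomial ℚ,
      FatPoints.IsHilbertPolynomial
        (FatPoints.kaehlerFormsComponent (FatPoints.coordRingComponent P m) (n + 1)) p ∧
      FatPoints.IsHilbertPolynomial (FatPoints.coordRingComponent P (fun j => m j - 1)) p ∧
      p = Polynomial.C ((∑ j, (m j + n - 2).choose n : ℕ) : ℚ) := by
  have hdim := finrank_homogeneousSubmodule_eq_add_sum hn P hP (fun j => m j - 1) Finset.univ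
  have hinf : (Finset.univ.inf fun j => pointIdeal (P j) ^ (m j - 1)) =
      fatPointIdeal P (fun j => m j - 1) := Finset.inf_univ_eq_iInf _
  rw [hinf] at hdim
  have hsum : ∑ j, (m j - 1 + n - 1).choose n = ∑ j, (m j + n - 2).choose n :=
    Finset.sum_congr rfl fun j _ => by
      have := hm j
      congr 1
      lia
  rw [hsum] at hdim
  refine ⟨_, ⟨fun i => ?_, ?_⟩, ⟨fun i => ?_, ?_⟩, rfl⟩
  · exact Submodule.finiteDimensional_of_le (kaehlerFormsComponent_le (fatPointIdeal P m) i)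
  · have hev := hdim.and (homogeneousSubmodule_inf_derivIdeal_eventually hn P hP m hm)
    -- Top forms of degree `i` have coefficients of degree `i - (n + 1)`; as the Hilbert function is
    -- eventually constant, the shift is harmless.
    filter_upwards [(Filter.tendsto_sub_atTop_nat (n + 1)).eventually hev,
      Filter.eventually_ge_atTop (n + 1)] with i ⟨h1, h2⟩ hi
    have heq : kaehlerFormsComponent (coordRingComponent P m) (n + 1) i =
        (homogeneousSubmodule (Fin (n + 1)) K (i - (n + 1))).map (volMap (fatPointIdeal P m)) := by
      refine le_antisymm (kaehlerFormsComponent_le (fatPointIdeal P m) i) ?_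
      have := le_kaehlerFormsComponent (fatPointIdeal P m) (i - (n + 1))
      rwa [Nat.sub_add_cancel hi] at this
    have h3 := finrank_map_add_finrank_inf_ker (volMap (fatPointIdeal P m))
      (homogeneousSubmodule (Fin (n + 1)) K (i - (n + 1)))
    rw [ker_volMap, h2, ← heq] at h3
    rw [Polynomial.eval_C, Nat.cast_inj]
    lia
  · exact Module.Finite.map _ _
  · filter_upwards [hdim] with i hi
    have h3 := finrank_map_add_finrank_inf_ker
      (Ideal.Quotient.mkₐ K (fatPointIdeal P (fun j => m j - 1))).toLinearMap
      (homogeneousSubmodule (Fin (n + 1)) K i)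
    have hker : LinearMap.ker
        (Ideal.Quotient.mkₐ K (fatPointIdeal P (fun j => m j - 1))).toLinearMap =
        (fatPointIdeal P (fun j => m j - 1)).restrictScalars K := by
      ext F
      exact Ideal.Quotient.eq_zero_iff_mem
    rw [hker] at h3
    rw [Polynomial.eval_C, Nat.cast_inj]
    exact Nat.add_left_cancel ((Nat.add_comm _ _).trans (h3.trans hi))
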